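/- Let $\mathcal H$ be a finite-dimensional complex Hilbert space and let $B(\mathcal H)$ be the complex vector space of linear operators on $\mathcal H$. Let $\mathsf A=\{\mathsf A(x)\}_{x\in\Omega}$ be an observable (POVM) on $\mathcal H$ with an at most countable outcome set $\Omega$, that is, a family of positive operators with $\sum_{x\in\Omega}\mathsf A(x)=\mathbb 1$, and let $\Lambda$ be a channel on $\mathcal H$, that is, a completely positive trace-preserving linear map $B(\mathcal H)\to B(\mathcal H)$. Suppose that $\mathsf A$ and $\Lambda$ are compatible: there are completely positive linear maps $\mathcal I_x\colon B(\mathcal H)\to B(\mathcal H)$, $x\in\Omega$, such that $\operatorname{tr}[\mathcal I_x(\rho)]=\operatorname{tr}[\rho\,\mathsf A(x)]$ for all $x$ and $\sum_{x\in\Omega}\mathcal I_x(\rho)=\Lambda(\rho)$, for all $\rho\in B(\mathcal H)$. Let $\Lambda^*$ be the dual map, defined by $\operatorname{tr}[\Lambda(\rho)X]=\operatorname{tr}[\rho\,\Lambda^*(X)]$, and let $\operatorname{Fix}(\Lambda^*)=\{X\in B(\mathcal H):\Lambda^*(X)=X\}$. Then $$\dim \operatorname{span}_{\mathbb C}\{\mathsf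 A(x):x\in\Omega\}+\dim\operatorname{Fix}(\Lambda^*)\le(\dim\mathcal H)^2+1 .$$ -/

import Mathlib

open scoped CStarAlgebra

noncomputable section

namespace QuantumMeasurement

/-- The trace of an operator on a finite-dimensional Hilbert space, as a linear functional. -/
def tr (H : Type*) [NormedAddCommGroup H] [InnerProductSpace ℂ H] :
    (H →L[ℂ] H) →ₗ[ℂ] ℂ :=
  LinearMap.trace ℂ H ∘ₗ ContinuousLinearMap.coeLM ℂ

/-- An observable (positive-operator-valued measure) with outcome set `Ω`: positive operators
`A x` whose sum is the identity (convergence is in operator norm when `Ω` is infinite). -/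
structure Observable (Ω H : Type*) [NormedAddCommGroup H] [InnerProductSpace ℂ H] where
  effect : Ω → (H →L[ℂ] H)
  positive : ∀ x, (effect x).IsPositive
  hasSum_one : HasSum effect 1

/-- The complex linear span of the operators `A x`. Since the operator space is
finite-dimensional, convergent infinite combinations of the `A x` lie in it as well. -/
def Observable.lnr {Ω H : Type*} [NormedAddCommGroup H] [InnerProductSpace ℂ H]
    (A : Observable Ω H) : Submodule ℂ (H →L[ℂ] H) :=
  Submodule.span ℂ (Set.range A.effect)

/-- A channel on `H` in the Schrödinger picture, extended linearly from states to all operators: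
a completely positive and trace-preserving linear map. -/
structure Channel (H : Type*) [NormedAddCommGroup H] [InnerProductSpace ℂ H] [CompleteSpace H]
    extends CompletelyPositiveMap (H →L[ℂ] H) (H →L[ℂ] H) where
  trace_preserving : ∀ ρ : H →L[ℂ] H, tr H (toLinearMap ρ) = tr H ρ

/-- An observable `A` and a channel `Λ` are compatible if one device (an instrument) realizes both:
completely positive maps `I x`, one for each outcome, such that the outcome `x` occurs in the
state `ρ` with probability `tr (I x ρ) = tr (ρ A(x))`, and the state change with the outcomes
ignored is `∑ x, I x ρ = Λ ρ`. -/
def Compatible {Ω H : Type*} [NormedAddCommGroup H] [InnerProductSpace ℂ H] [CompleteSpace H]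
    (A : Observable Ω H) (Λ : Channel H) : Prop :=
  ∃ I : Ω → CompletelyPositiveMap (H →L[ℂ] H) (H →L[ℂ] H),
    (∀ x ρ, tr H (I x ρ) = tr H (ρ * A.effect x)) ∧
    (∀ ρ, HasSum (fun x => I x ρ) (Λ.toLinearMap ρ))

section Dual

variable {H : Type*} [NormedAddCommGroup H] [InnerProductSpace ℂ H] [FiniteDimensional ℂ H]

/-- The Heisenberg-picture dual of a linear map `Φ` on operators: with an orthonormal basis `e`,
the matrix entry `⟪e i, dual Φ X (e j)⟫` is `tr (Φ (|e j⟩⟨e i|) X)`. It is the unique linear map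
with `tr (Φ ρ X) = tr (ρ (dual Φ X))`; see `tr_dual` and `dual_unique` below. -/
def dual (Φ : (H →L[ℂ] H) →ₗ[ℂ] (H →L[ℂ] H)) : (H →L[ℂ] H) →ₗ[ℂ] (H →L[ℂ] H) :=
  let e := stdOrthonormalBasis ℂ H
  ∑ i, ∑ j,
    (tr H ∘ₗ LinearMap.mulLeft ℂ (Φ (InnerProductSpace.rankOne ℂ (e j) (e i)))).smulRight
      (InnerProductSpace.rankOne ℂ (e i) (e j))

theorem tr_mul_rankOne (X : H →L[ℂ] H) (u v : H) :
    tr H (X * InnerProductSpace.rankOne ℂ u v) = inner ℂ v (X u) := by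
  have := LinearMap.trace_eq_sum_inner
    ((X * InnerProductSpace.rankOne ℂ u v : H →L[ℂ] H) : H →ₗ[ℂ] H) (stdOrthonormalBasis ℂ H)
  rw [← OrthonormalBasis.sum_inner_mul_inner (stdOrthonormalBasis ℂ H) v (X u)]
  simpa [tr, inner_smul_right] using this

theorem tr_dual (Φ : (H →L[ℂ] H) →ₗ[ℂ] (H →L[ℂ] H)) (ρ X : H →L[ℂ] H) :
    tr H (Φ ρ * X) = tr H (ρ * dual Φ X) := by
  set e := stdOrthonormalBasis ℂ H with he
  have h : ρ = ∑ i, ∑ j, inner ℂ (e j) (ρ (e i)) •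
      InnerProductSpace.rankOne ℂ (e j) (e i) := by
    ext v
    simp only [sum_apply, smul_apply,
      InnerProductSpace.rankOne_apply]
    conv_lhs => rw [← e.sum_repr' v, map_sum]
    refine Finset.sum_congr rfl fun i _ => ?_
    conv_lhs => rw [map_smul, ← e.sum_repr' (ρ (e i)), Finset.smul_sum]
    exact Finset.sum_congr rfl fun j _ => smul_comm _ _ _
  have hd : dual Φ X = ∑ i, ∑ j,
      tr H (Φ (InnerProductSpace.rankOne ℂ (e j) (e i)) * X) •
        InnerProductSpace.rankOne ℂ (e i) (e j) := by
    simp [dual, he, LinearMap.sum_apply]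
  rw [hd]
  conv_lhs => rw [h]
  simp only [map_sum, map_smul, Finset.mul_sum, Finset.sum_mul, mul_smul_comm, smul_mul_assoc,
    tr_mul_rankOne, smul_eq_mul]
  exact Finset.sum_congr rfl fun i _ => Finset.sum_congr rfl fun j _ => mul_comm _ _

theorem dual_unique (Φ Ψ : (H →L[ℂ] H) →ₗ[ℂ] (H →L[ℂ] H))
    (h : ∀ ρ X, tr H (Φ ρ * X) = tr H (ρ * Ψ X)) : Ψ = dual Φ := by
  have hc (X Y : H →L[ℂ] H) : tr H (X * Y) = tr H (Y * X) :=
    LinearMap.trace_mul_comm ℂ (X : H →ₗ[ℂ] H) (Y : H →ₗ[ℂ] H)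
  ext X u
  refine ext_inner_left ℂ fun v => ?_
  rw [← tr_mul_rankOne, ← tr_mul_rankOne, hc, ← h, hc (dual Φ X), tr_dual]

/-- The fixed points of the Heisenberg dual of a channel. -/
def Channel.fixDual [CompleteSpace H] (Λ : Channel H) : Submodule ℂ (H →L[ℂ] H) :=
  LinearMap.eqLocus (dual Λ.toLinearMap) LinearMap.id

end Dual

end QuantumMeasurement

end

noncomputable section

namespace QuantumMeasurement

/-! Write $n=\dim\mathcal H$. Two facts carry the proof.

Commutation: let $\omega$ be a positive fixed point of $\Lambda$ whose support $S$ is large enough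
that compression to $S$ is injective on $\operatorname{Fix}(\Lambda^*)$. Cesàro limits of
$\Lambda^k(\mathbb 1)$ provide one (`exists_dominating_fixedPoint`). For a Kraus operator $K$ of the
instrument and a compressed fixed point $Y$, the nonnegative numbers $\operatorname{tr}[B\omega
B^*]$ with $B=KY-YK$ sum to zero, so $KY=YK$ on $S$ (`kraus_mul_compression`). Since $\mathsf
A(x)=\sum_k K_{x,k}^*K_{x,k}$, the compressed effects commute with the compressed fixed points.

Dimension: if $M=M^*$ and $C$ commute and both contain $\mathbb 1$, then $M\cap C$ consists of
commuting normal operators and has a separating vector $v$. The functionals $Y\mapsto\langle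
v,[z,Y]v\rangle$, $z\in M\cap C$, annihilate $M+C$ and vanish identically only for scalar $z$. Hence
$\dim(M\cap C)-1\le(\dim S)^2-\dim(M+C)$, that is, $\dim M+\dim C\le(\dim S)^2+1$
(`finrank_add_finrank_le_of_commute`).

Compression loses nothing on the fixed points and at most $n^2-(\dim S)^2$ dimensions on the span of
the effects, which gives the bound. -/

theorem finrank_operators (V : Type*) [NormedAddCommGroup V] [InnerProductSpace ℂ V]
    [FiniteDimensional ℂ V] :
    Module.finrank ℂ (V →L[ℂ] V) = Module.finrank ℂ V ^ 2 := by
  rw [← (LinearMap.toContinuousLinearMap (𝕜 := ℂ) (E := V) (F' := V)).finrank_eq,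
    Module.finrank_linearMap, sq]

/-! ### Dimension bound for commuting operator spaces. -/

section Commuting

variable {V : Type*} [NormedAddCommGroup V] [InnerProductSpace ℂ V]

/-- By normality, $\|z^*zw\|^2=\langle zw,z^*z(zw)\rangle=0$, and then $\|zw\|^2=\langle
w,z^*zw\rangle=0$. -/
theorem apply_eq_zero_of_sq_apply [CompleteSpace V] {z : V →L[ℂ] V} (hz : star z * z = z * star z)
    {w : V}
    (h : z (z w) = 0) : z w = 0 := by
  have h1 : star z (z w) = 0 := by
    have : inner ℂ (star z (z w)) (star z (z w)) = (0 : ℂ) := by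
      rw [ContinuousLinearMap.star_eq_adjoint, ContinuousLinearMap.adjoint_inner_left,
        ← ContinuousLinearMap.star_eq_adjoint]
      have : z (star z (z w)) = (z * star z) (z w) := rfl
      rw [this, ← hz]
      simp [h]
    exact inner_self_eq_zero.mp this
  rw [ContinuousLinearMap.star_eq_adjoint] at h1
  have := ContinuousLinearMap.adjoint_inner_left z w (z w)
  rw [h1, inner_zero_left] at this
  exact inner_self_eq_zero.mp this.symm

/-- A linear space of commuting normal operators has a separating vector. -/
theorem exists_separating_vector [CompleteSpace V] [FiniteDimensional ℂ V]
    (Z : Submodule ℂ (V →L[ℂ] V))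
    (hc : ∀ y ∈ Z, ∀ z ∈ Z, y * z = z * y) (hn : ∀ z ∈ Z, star z * z = z * star z) :
    ∃ v : V, ∀ z ∈ Z, z v = 0 → z = 0 := by
  let ev : V → Submodule ℂ (V →L[ℂ] V) := fun v =>
    Z ⊓ LinearMap.ker (ContinuousLinearMap.apply ℂ V v : (V →L[ℂ] V) →L[ℂ] V).toLinearMap
  have mem_ev (v : V) (z : V →L[ℂ] V) : z ∈ ev v ↔ z ∈ Z ∧ z v = 0 := by simp [ev]
  -- Take $v$ with the smallest annihilator in $Z$. If some $z\ne0$ in $Z$ killed $v$, passing to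
  -- $v+zw$ with $zw\ne0$ would shrink the annihilator strictly.
  obtain ⟨v, hv⟩ : ∃ v, ∀ u, Module.finrank ℂ (ev v) ≤ Module.finrank ℂ (ev u) :=
    ⟨_, fun u => Function.argmin_le (fun v => Module.finrank ℂ (ev v)) u⟩
  refine ⟨v, fun z hz hzv => ?_⟩
  by_contra hne
  obtain ⟨w, hw⟩ : ∃ w, z w ≠ 0 := by
    by_contra! h
    exact hne (ContinuousLinearMap.ext h)
  have hlt : ev (v + z w) < ev v := by
    refine lt_of_le_of_ne (fun y hy => ?_) fun heq => ?_
    · rw [mem_ev] at hy ⊢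
      obtain ⟨hyZ, hy⟩ := hy
      have hcomm (u : V) : z (y u) = y (z u) := DFunLike.congr_fun (hc z hz y hyZ) u
      have h1 : z (y (z w)) = 0 := by
        have := congrArg z hy
        rwa [map_add, map_add, hcomm v, hzv, map_zero, zero_add, map_zero] at this
      have h2 : y (z w) = 0 := by
        rw [← hcomm] at h1 ⊢
        exact apply_eq_zero_of_sq_apply (hn z hz) h1
      exact ⟨hyZ, by simpa [h2] using hy⟩
    · have : z ∈ ev (v + z w) := by rw [heq, mem_ev]; exact ⟨hz, hzv⟩
      rw [mem_ev, map_add, hzv, zero_add] at this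
      exact hw (apply_eq_zero_of_sq_apply (hn z hz) this.2)
  exact absurd (hv (v + z w)) (not_le.mpr (Submodule.finrank_lt_finrank_of_lt hlt))

/-- The functional `Y ↦ ⟪v, [z, Y] v⟫`, linear in `z`. -/
def commutatorForm (v : V) : (V →L[ℂ] V) →ₗ[ℂ] Module.Dual ℂ (V →L[ℂ] V) :=
  (LinearMap.mul ℂ (V →L[ℂ] V) - (LinearMap.mul ℂ (V →L[ℂ] V)).flip).compr₂
    ((innerSL ℂ v ∘L ContinuousLinearMap.apply ℂ V v : (V →L[ℂ] V) →L[ℂ] ℂ) :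
      (V →L[ℂ] V) →ₗ[ℂ] ℂ)

theorem commutatorForm_apply (v : V) (z Y : V →L[ℂ] V) :
    commutatorForm v z Y = inner ℂ v (z (Y v)) - inner ℂ v (Y (z v)) := by
  simp [commutatorForm, inner_sub_right]

theorem exists_apply_eq_smul_of_commutatorForm_eq_zero {v : V} {z : V →L[ℂ] V}
    (h : commutatorForm v z = 0) : ∃ c : ℂ, z v = c • v := by
  by_cases hv : v = 0
  · exact ⟨0, by simp [hv]⟩
  have h1 : (inner ℂ v v : ℂ) ≠ 0 := inner_self_ne_zero.mpr hv
  refine ⟨(inner ℂ v v)⁻¹ * inner ℂ v (z v), ?_⟩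
  refine ext_inner_left ℂ fun b => ?_
  -- Testing on $Y=|v\rangle\langle b|$ gives $\langle v,zv\rangle\langle b,v\rangle=\langle
  -- v,v\rangle\langle b,zv\rangle$ for every $b$.
  have := commutatorForm_apply v z (InnerProductSpace.rankOne ℂ v b)
  rw [h] at this
  simp only [LinearMap.zero_apply, InnerProductSpace.rankOne_apply, map_smul,
    inner_smul_right] at this
  rw [inner_smul_right]
  field_simp
  linear_combination this

/-- Two commuting spaces of operators, one of them self-adjoint, both containing the identity,
have dimensions adding up to at most `n ^ 2 + 1`. -/
theorem finrank_add_finrank_le_of_commute [CompleteSpace V] [FiniteDimensional ℂ V]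
    (M C : Submodule ℂ (V →L[ℂ] V)) (hM : ∀ m ∈ M, star m ∈ M)
    (hM1 : 1 ∈ M) (hC1 : 1 ∈ C) (hcomm : ∀ m ∈ M, ∀ c ∈ C, m * c = c * m) :
    Module.finrank ℂ M + Module.finrank ℂ C ≤ Module.finrank ℂ V ^ 2 + 1 := by
  obtain ⟨v, hv⟩ := exists_separating_vector (M ⊓ C)
    (fun y hy z hz => hcomm y hy.1 z hz.2) (fun z hz => hcomm _ (hM z hz.1) z hz.2)
  let φ := (commutatorForm v).domRestrict (M ⊓ C)
  have hker : Module.finrank ℂ (LinearMap.ker φ) ≤ 1 := by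
    have hle : LinearMap.ker φ ≤ Submodule.span ℂ {(⟨1, hM1, hC1⟩ : ↥(M ⊓ C))} := by
      rintro ⟨z, hz⟩ hφ
      obtain ⟨c, hcv⟩ := exists_apply_eq_smul_of_commutatorForm_eq_zero (v := v) (z := z) hφ
      refine Submodule.mem_span_singleton.mpr ⟨c, Subtype.ext ?_⟩
      exact (sub_eq_zero.mp (hv (z - c • 1) (sub_mem hz (Submodule.smul_mem _ c ⟨hM1, hC1⟩))
        (by simp [hcv]))).symm
    exact (Submodule.finrank_mono hle).trans ((finrank_span_le_card _).trans (by simp))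
  have hrange : LinearMap.range φ ≤ (M ⊔ C).dualAnnihilator := by
    rintro _ ⟨⟨z, hz⟩, rfl⟩
    rw [Submodule.mem_dualAnnihilator]
    intro Y hY
    have : z * Y = Y * z := by
      obtain ⟨m, hm, c, hc, rfl⟩ := Submodule.mem_sup.mp hY
      rw [mul_add, add_mul, hcomm z hz.1 c hc, hcomm m hm z hz.2]
    change commutatorForm v z Y = 0
    rw [commutatorForm_apply, sub_eq_zero]
    exact congrArg (inner ℂ v) (DFunLike.congr_fun this v)
  have h1 := LinearMap.finrank_range_add_finrank_ker φ
  have h2 := Submodule.finrank_mono hrange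
  have h3 := Subspace.finrank_add_finrank_dualAnnihilator_eq (M ⊔ C)
  have h4 := Submodule.finrank_sup_add_finrank_inf_eq M C
  rw [finrank_operators] at h3
  omega

end Commuting

open InnerProductSpace

theorem nonneg_iff_exists_star_mul_self {A : Type*} [NonUnitalCStarAlgebra A] [PartialOrder A]
    [StarOrderedRing A] (a : A) : 0 ≤ a ↔ ∃ b, a = star b * b :=
  CStarAlgebra.nonneg_iff_eq_star_mul_self

/-! ### Trace, Hilbert–Schmidt estimates and rank-one operators. -/

section Trace

variable {H : Type*} [NormedAddCommGroup H] [InnerProductSpace ℂ H]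

theorem tr_mul_comm (X Y : H →L[ℂ] H) : tr H (X * Y) = tr H (Y * X) :=
  LinearMap.trace_mul_comm ℂ (X : H →ₗ[ℂ] H) (Y : H →ₗ[ℂ] H)

variable [FiniteDimensional ℂ H]

omit [FiniteDimensional ℂ H] in
theorem tr_eq_sum_inner {ι : Type*} [Fintype ι] (e : OrthonormalBasis ι ℂ H) (X : H →L[ℂ] H) :
    tr H X = ∑ i, inner ℂ (e i) (X (e i)) :=
  LinearMap.trace_eq_sum_inner (X : H →ₗ[ℂ] H) e

theorem eq_of_tr_mul_eq {X Y : H →L[ℂ] H} (h : ∀ ρ, tr H (ρ * X) = tr H (ρ * Y)) : X = Y := by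
  ext u
  refine ext_inner_left ℂ fun v => ?_
  rw [← tr_mul_rankOne, ← tr_mul_rankOne, tr_mul_comm, h, tr_mul_comm]

omit [FiniteDimensional ℂ H] in
theorem linearMap_ext_rankOne {W ι : Type*} [AddCommGroup W] [Module ℂ W] [Fintype ι]
    (e : OrthonormalBasis ι ℂ H) {Φ Ψ : (H →L[ℂ] H) →ₗ[ℂ] W}
    (h : ∀ i j, Φ (rankOne ℂ (e i) (e j)) = Ψ (rankOne ℂ (e i) (e j))) : Φ = Ψ := by
  ext ρ
  have hρ : ρ = ∑ i, ∑ j, inner ℂ (e j) (ρ (e i)) • rankOne ℂ (e j) (e i) := by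
    ext v
    simp only [sum_apply, smul_apply, rankOne_apply]
    conv_lhs => rw [← e.sum_repr' v, map_sum]
    refine Finset.sum_congr rfl fun i _ => ?_
    conv_lhs => rw [map_smul, ← e.sum_repr' (ρ (e i)), Finset.smul_sum]
    exact Finset.sum_congr rfl fun j _ => smul_comm _ _ _
  rw [hρ]
  simp only [map_sum, map_smul, h]

variable [CompleteSpace H]

omit [FiniteDimensional ℂ H] in
theorem inner_star_apply (X : H →L[ℂ] H) (u v : H) :
    inner ℂ (star X u) v = inner ℂ u (X v) := by
  rw [ContinuousLinearMap.star_eq_adjoint, ContinuousLinearMap.adjoint_inner_left]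

omit [FiniteDimensional ℂ H] in
theorem inner_apply_star (X : H →L[ℂ] H) (u v : H) :
    inner ℂ u (star X v) = inner ℂ (X u) v := by
  rw [ContinuousLinearMap.star_eq_adjoint, ContinuousLinearMap.adjoint_inner_right]

theorem tr_star (X : H →L[ℂ] H) : tr H (star X) = star (tr H X) := by
  rw [tr_eq_sum_inner (stdOrthonormalBasis ℂ H), tr_eq_sum_inner (stdOrthonormalBasis ℂ H),
    star_sum]
  refine Finset.sum_congr rfl fun i _ => ?_
  rw [inner_apply_star]
  exact (inner_conj_symm _ _).symm

theorem tr_star_mul_self (X : H →L[ℂ] H) :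
    tr H (star X * X) = ((∑ i, ‖X (stdOrthonormalBasis ℂ H i)‖ ^ 2 : ℝ) : ℂ) := by
  rw [tr_eq_sum_inner (stdOrthonormalBasis ℂ H), Complex.ofReal_sum]
  refine Finset.sum_congr rfl fun i _ => ?_
  rw [mul_apply_eq_comp, inner_apply_star, inner_self_eq_norm_sq_to_K]
  simp

theorem eq_zero_of_tr_star_mul_self {X : H →L[ℂ] H} (h : (tr H (star X * X)).re = 0) : X = 0 := by
  rw [tr_star_mul_self, Complex.ofReal_re, Finset.sum_eq_zero_iff_of_nonneg
    fun _ _ => sq_nonneg _] at h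
  refine ContinuousLinearMap.coe_injective ((stdOrthonormalBasis ℂ H).toBasis.ext fun i => ?_)
  simpa using h i (Finset.mem_univ i)

theorem tr_star_mul_self_nonneg (X : H →L[ℂ] H) : 0 ≤ (tr H (star X * X)).re := by
  rw [tr_star_mul_self, Complex.ofReal_re]
  positivity

theorem norm_apply_sq_le_tr (X : H →L[ℂ] H) (v : H) :
    ‖X v‖ ^ 2 ≤ (tr H (star X * X)).re * ‖v‖ ^ 2 := by
  rw [tr_star_mul_self, Complex.ofReal_re]
  set e := stdOrthonormalBasis ℂ H
  have h1 : ‖X v‖ ≤ ∑ i, ‖X (e i)‖ * ‖inner ℂ (e i) v‖ := by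
    conv_lhs => rw [← e.sum_repr' v, map_sum]
    refine (norm_sum_le _ _).trans (Finset.sum_le_sum fun i _ => ?_)
    rw [map_smul, norm_smul, mul_comm]
  calc ‖X v‖ ^ 2 ≤ (∑ i, ‖X (e i)‖ * ‖inner ℂ (e i) v‖) ^ 2 := by gcongr
    _ ≤ _ := Finset.sum_mul_sq_le_sq_mul_sq _ _ _
    _ = _ := by rw [e.sum_sq_norm_inner_right]

/-- With $\omega=R^*R$ this compares the operator norm of $R$ with its Hilbert–Schmidt norm. -/
theorem norm_le_tr {ω : H →L[ℂ] H} (h : 0 ≤ ω) : ‖ω‖ ≤ (tr H ω).re := by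
  obtain ⟨R, rfl⟩ := (nonneg_iff_exists_star_mul_self ω).mp h
  rw [CStarRing.norm_star_mul_self, ← sq]
  have h0 := tr_star_mul_self_nonneg R
  refine (Real.le_sqrt (norm_nonneg _) h0).mp ?_
  refine R.opNorm_le_bound (Real.sqrt_nonneg _) fun v => ?_
  refine (sq_le_sq₀ (norm_nonneg _) (by positivity)).mp ?_
  rw [mul_pow, Real.sq_sqrt h0]
  exact norm_apply_sq_le_tr R v

omit [FiniteDimensional ℂ H] in
theorem star_rankOne (u v : H) : star (rankOne ℂ u v) = rankOne ℂ v u := by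
  rw [ContinuousLinearMap.star_eq_adjoint, adjoint_rankOne]

omit [FiniteDimensional ℂ H] [CompleteSpace H] in
theorem mul_rankOne (X : H →L[ℂ] H) (u v : H) : X * rankOne ℂ u v = rankOne ℂ (X u) v := by
  ext w; simp

omit [FiniteDimensional ℂ H] in
theorem rankOne_mul (X : H →L[ℂ] H) (u v : H) :
    rankOne ℂ u v * X = rankOne ℂ u (star X v) := by
  ext w; simp [inner_star_apply]

omit [FiniteDimensional ℂ H] [CompleteSpace H] in
theorem rankOne_mul_rankOne (u v w x : H) :
    rankOne ℂ u v * rankOne ℂ w x = (inner ℂ v w : ℂ) • rankOne ℂ u x := by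
  rw [mul_rankOne]; simp

end Trace

/-! ### Kraus decomposition through the Choi matrix. -/

section Kraus

variable {H : Type*} [NormedAddCommGroup H] [InnerProductSpace ℂ H] [CompleteSpace H]
  [FiniteDimensional ℂ H]

/-- Every completely positive map has a Kraus decomposition. -/
theorem exists_kraus (Φ : CompletelyPositiveMap (H →L[ℂ] H) (H →L[ℂ] H)) :
    ∃ (n : ℕ) (K : Fin n × Fin n → (H →L[ℂ] H)), ∀ ρ, Φ ρ = ∑ k, K k * ρ * star (K k) := by
  classical
  let e := stdOrthonormalBasis ℂ H
  refine ⟨Module.finrank ℂ H, ?_⟩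
  rcases isEmpty_or_nonempty (Fin (Module.finrank ℂ H)) with hemp | ⟨⟨k₀⟩⟩
  · refine ⟨0, fun ρ => ?_⟩
    refine ContinuousLinearMap.coe_injective (e.toBasis.ext fun i => hemp.elim i)
  let E : CStarMatrix (Fin (Module.finrank ℂ H)) (Fin (Module.finrank ℂ H)) (H →L[ℂ] H) :=
    CStarMatrix.ofMatrix fun i j => rankOne ℂ (e i) (e j)
  have hE : 0 ≤ E := by
    refine (nonneg_iff_exists_star_mul_self E).mpr
      -- A single nonzero row, in an arbitrary position `k₀`, is a square root of the Choi matrix.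
      ⟨CStarMatrix.ofMatrix fun k j => if k = k₀ then rankOne ℂ (e k₀) (e j) else 0, ?_⟩
    refine CStarMatrix.ext fun i j => ?_
    rw [CStarMatrix.mul_apply]
    change rankOne ℂ (e i) (e j) = ∑ k, star (if k = k₀ then rankOne ℂ (e k₀) (e i) else 0) *
      (if k = k₀ then rankOne ℂ (e k₀) (e j) else 0)
    simp [apply_ite, star_rankOne, rankOne_mul_rankOne]
  obtain ⟨N, hN⟩ := (nonneg_iff_exists_star_mul_self _).mp
    (Φ.map_cstarMatrix_nonneg' _ E hE)
  have hΦ (i j) : Φ (rankOne ℂ (e i) (e j)) = ∑ k, star (N k i) * N k j := by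
    have := congrFun (congrFun hN i) j
    rw [CStarMatrix.mul_apply] at this
    exact this
  -- Chosen so that $K_{(k,l)}e_i=N_{ki}^*e_l$; summing over $l$ then resolves the identity between
  -- $N_{ki}^*$ and $N_{kj}$.
  let K (k : Fin (Module.finrank ℂ H) × Fin (Module.finrank ℂ H)) : H →L[ℂ] H :=
    ∑ i, rankOne ℂ (star (N k.1 i) (e k.2)) (e i)
  have hK (k i) : K k (e i) = star (N k.1 i) (e k.2) := by
    simp [K, e.inner_eq_ite]
  refine ⟨K, fun ρ => ?_⟩
  let Ψ : (H →L[ℂ] H) →ₗ[ℂ] (H →L[ℂ] H) :=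
    ∑ k, LinearMap.mulLeft ℂ (K k) ∘ₗ LinearMap.mulRight ℂ (star (K k))
  have hΨ (ρ) : Ψ ρ = ∑ k, K k * ρ * star (K k) := by simp [Ψ, mul_assoc]
  rw [← hΨ]
  refine LinearMap.congr_fun (f := Φ.toLinearMap)
    (linearMap_ext_rankOne e fun i j => (hΦ i j).trans ?_) ρ
  rw [hΨ, Fintype.sum_prod_type]
  refine Finset.sum_congr rfl fun k _ => ?_
  have h1 := e.sum_rankOne_eq_id
  calc star (N k i) * N k j = star (N k i) * (∑ l, rankOne ℂ (e l) (e l)) * N k j := by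
        rw [h1]; rfl
    _ = _ := by
        rw [Finset.mul_sum, Finset.sum_mul]
        refine Finset.sum_congr rfl fun l _ => ?_
        rw [mul_rankOne, rankOne_mul, mul_rankOne, rankOne_mul, star_star, hK, hK]

end Kraus

/-! ### Fixed points from Cesàro means. -/

section Cesaro

open Filter Topology

variable {H : Type*} [NormedAddCommGroup H] [InnerProductSpace ℂ H] [CompleteSpace H]
  [FiniteDimensional ℂ H]

/-- The Cesàro means of the iterates of a linear map. -/
def cesaro (L : (H →L[ℂ] H) →ₗ[ℂ] (H →L[ℂ] H)) (N : ℕ) (ρ : H →L[ℂ] H) : H →L[ℂ] H :=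
  ((N + 1 : ℝ)⁻¹) • ∑ n ∈ Finset.range (N + 1), (L ^ n) ρ

variable {L : (H →L[ℂ] H) →ₗ[ℂ] (H →L[ℂ] H)}

omit [CompleteSpace H] [FiniteDimensional ℂ H] in
theorem pow_apply_nonneg (hpos : ∀ ρ, 0 ≤ ρ → 0 ≤ L ρ) {ρ : H →L[ℂ] H} (hρ : 0 ≤ ρ) (n : ℕ) :
    0 ≤ (L ^ n) ρ := by
  induction n with
  | zero => simpa
  | succ n ih => rw [pow_succ']; exact hpos _ ih

omit [CompleteSpace H] [FiniteDimensional ℂ H] in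
theorem tr_pow_apply_mul {X : H →L[ℂ] H} (hX : ∀ ρ, tr H (L ρ * X) = tr H (ρ * X))
    (ρ : H →L[ℂ] H) (n : ℕ) : tr H ((L ^ n) ρ * X) = tr H (ρ * X) := by
  induction n with
  | zero => simp
  | succ n ih => rw [pow_succ', Module.End.mul_apply, hX, ih]

theorem norm_pow_apply_le (hpos : ∀ ρ, 0 ≤ ρ → 0 ≤ L ρ) (htr : ∀ ρ, tr H (L ρ) = tr H ρ)
    {ρ : H →L[ℂ] H} (hρ : 0 ≤ ρ) (n : ℕ) : ‖(L ^ n) ρ‖ ≤ (tr H ρ).re := by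
  have h := tr_pow_apply_mul (X := 1) (by simpa using htr) ρ n
  rw [mul_one, mul_one] at h
  rw [← h]
  exact norm_le_tr (pow_apply_nonneg hpos hρ n)

omit [FiniteDimensional ℂ H] in
theorem cesaro_nonneg (hpos : ∀ ρ, 0 ≤ ρ → 0 ≤ L ρ) {ρ : H →L[ℂ] H} (hρ : 0 ≤ ρ) (N : ℕ) :
    0 ≤ cesaro L N ρ :=
  smul_nonneg (by positivity) (Finset.sum_nonneg fun n _ => pow_apply_nonneg hpos hρ n)

omit [CompleteSpace H] [FiniteDimensional ℂ H] in
theorem tr_cesaro_mul {X : H →L[ℂ] H} (hX : ∀ ρ, tr H (L ρ * X) = tr H (ρ * X))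
    (ρ : H →L[ℂ] H) (N : ℕ) : tr H (cesaro L N ρ * X) = tr H (ρ * X) := by
  rw [cesaro, smul_mul_assoc, LinearMap.map_smul_of_tower, Finset.sum_mul, map_sum]
  simp only [tr_pow_apply_mul hX, Finset.sum_const, Finset.card_range, nsmul_eq_mul,
    Complex.real_smul]
  push_cast
  field_simp

theorem norm_cesaro_le (hpos : ∀ ρ, 0 ≤ ρ → 0 ≤ L ρ) (htr : ∀ ρ, tr H (L ρ) = tr H ρ)
    {ρ : H →L[ℂ] H} (hρ : 0 ≤ ρ) (N : ℕ) : ‖cesaro L N ρ‖ ≤ (tr H ρ).re := by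
  have h := tr_cesaro_mul (X := 1) (by simpa using htr) ρ N
  rw [mul_one, mul_one] at h
  rw [← h]
  exact norm_le_tr (cesaro_nonneg hpos hρ N)

/-- The trace bounds the norm of the positive means, so they stay in a compact ball. One fixed
ultrafilter serves every `ρ`, so that limits for different `ρ` can be compared. -/
theorem exists_tendsto_cesaro (hpos : ∀ ρ, 0 ≤ ρ → 0 ≤ L ρ) (htr : ∀ ρ, tr H (L ρ) = tr H ρ)
    {ρ : H →L[ℂ] H} (hρ : 0 ≤ ρ) :
    ∃ τ, Tendsto (fun N => cesaro L N ρ) (hyperfilter ℕ) (𝓝 τ) := by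
  have : ProperSpace (H →L[ℂ] H) := FiniteDimensional.proper ℂ _
  obtain ⟨τ, -, hτ⟩ := (isCompact_closedBall (0 : H →L[ℂ] H) (tr H ρ).re).ultrafilter_le_nhds
    ((hyperfilter ℕ).map fun N => cesaro L N ρ)
    (by
      rw [Ultrafilter.coe_map, le_principal_iff, mem_map]
      exact univ_mem' fun N => by simpa using norm_cesaro_le hpos htr hρ N)
  exact ⟨τ, hτ⟩

omit [CompleteSpace H] [FiniteDimensional ℂ H] in
theorem apply_cesaro_sub (N : ℕ) (ρ : H →L[ℂ] H) :
    L (cesaro L N ρ) - cesaro L N ρ = ((N + 1 : ℝ)⁻¹) • ((L ^ (N + 1)) ρ - ρ) := by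
  rw [cesaro, LinearMap.map_smul_of_tower, ← smul_sub, map_sum, ← Finset.sum_sub_distrib]
  congr 1
  have := Finset.sum_range_sub (fun n => (L ^ n) ρ) (N + 1)
  rw [← (by simpa using this : _ = (L ^ (N + 1)) ρ - ρ)]
  simp [pow_succ']

theorem apply_eq_of_tendsto_cesaro (hpos : ∀ ρ, 0 ≤ ρ → 0 ≤ L ρ)
    (htr : ∀ ρ, tr H (L ρ) = tr H ρ) {ρ τ : H →L[ℂ] H} (hρ : 0 ≤ ρ)
    (h : Tendsto (fun N => cesaro L N ρ) (hyperfilter ℕ) (𝓝 τ)) : L τ = τ := by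
  have hL : Continuous L := L.continuous_of_finiteDimensional
  have h1 := ((hL.tendsto τ).comp h).sub h
  have h2 : Tendsto (fun N : ℕ => ((N + 1 : ℝ)⁻¹) • ((L ^ (N + 1)) ρ - ρ)) atTop (𝓝 0) := by
    refine squeeze_zero_norm (a := fun N : ℕ => 1 / ((N : ℝ) + 1) * ((tr H ρ).re + ‖ρ‖))
      (fun N => ?_) ?_
    · rw [norm_smul, Real.norm_of_nonneg (by positivity), one_div]
      gcongr
      exact (norm_sub_le _ _).trans (by gcongr; exact norm_pow_apply_le hpos htr hρ _)
    · simpa using tendsto_one_div_add_atTop_nhds_zero_nat.mul_const ((tr H ρ).re + ‖ρ‖)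
  refine sub_eq_zero.mp (tendsto_nhds_unique h1 ?_)
  refine (h2.mono_left Nat.hyperfilter_le_atTop).congr fun N => ?_
  exact (apply_cesaro_sub N ρ).symm

/-- A positive trace-preserving map has a positive fixed point `ω` such that every functional
`ρ ↦ tr (ρ X)` invariant under the map is determined by its values on operators below multiples
of `ω`. -/
theorem exists_dominating_fixedPoint (hpos : ∀ ρ, 0 ≤ ρ → 0 ≤ L ρ)
    (htr : ∀ ρ, tr H (L ρ) = tr H ρ) :
    ∃ ω, 0 ≤ ω ∧ L ω = ω ∧ ∀ ρ, 0 ≤ ρ → ∃ (τ : H →L[ℂ] H) (c : ℝ), 0 ≤ τ ∧ τ ≤ c • ω ∧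
      ∀ X, (∀ σ, tr H (L σ * X) = tr H (σ * X)) → tr H (ρ * X) = tr H (τ * X) := by
  obtain ⟨ω, hω⟩ := exists_tendsto_cesaro hpos htr (zero_le_one : (0 : H →L[ℂ] H) ≤ 1)
  refine ⟨ω, ge_of_tendsto' hω (cesaro_nonneg hpos zero_le_one),
    apply_eq_of_tendsto_cesaro hpos htr zero_le_one hω, fun ρ hρ => ?_⟩
  obtain ⟨τ, hτ⟩ := exists_tendsto_cesaro hpos htr hρ
  refine ⟨τ, ‖ρ‖, ge_of_tendsto' hτ (cesaro_nonneg hpos hρ),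
    le_of_tendsto_of_tendsto' hτ (hω.const_smul ‖ρ‖) fun N => ?_, fun X hX => ?_⟩
  -- Domination: $\rho\le\|\rho\|\mathbb 1$ survives the positive Cesàro means and their limit.
  · have h1 : 0 ≤ ‖ρ‖ • 1 - ρ := by
      rw [sub_nonneg, ← Algebra.algebraMap_eq_smul_one]
      exact (IsSelfAdjoint.of_nonneg hρ).le_algebraMap_norm_self
    have h2 := cesaro_nonneg hpos h1 N
    rw [← sub_nonneg]
    refine h2.trans_eq ?_
    simp [cesaro, Finset.smul_sum, smul_sub, smul_comm ‖ρ‖]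
  · have hcont : Continuous fun σ : H →L[ℂ] H => tr H (σ * X) :=
      (tr H ∘ₗ LinearMap.mulRight ℂ X).continuous_of_finiteDimensional
    refine tendsto_nhds_unique ?_ ((hcont.tendsto τ).comp hτ)
    refine tendsto_const_nhds.congr fun N => ?_
    exact (tr_cesaro_mul hX ρ N).symm

end Cesaro

theorem hasSum_of_eq {α β : Type*} [AddCommMonoid β] [TopologicalSpace β] {f g : α → β} {b : β}
    (h : HasSum f b) (hfg : ∀ x, g x = f x) : HasSum g b := by
  rwa [funext hfg]

/-! ### Support projections of positive operators. -/

section Support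

variable {H : Type*} [NormedAddCommGroup H] [InnerProductSpace ℂ H] [CompleteSpace H]
  [FiniteDimensional ℂ H]

/-- `P` is the support projection of the positive operator `ω`. -/
structure IsSupport (ω P : H →L[ℂ] H) : Prop where
  nonneg : 0 ≤ ω
  star_eq : star P = P
  mul_self : P * P = P
  apply_eq_zero_iff : ∀ v, P v = 0 ↔ ω v = 0

theorem isSupport_starProjection_range {ω : H →L[ℂ] H} (hω : 0 ≤ ω) :
    IsSupport ω ω.range.starProjection where
  nonneg := hω
  star_eq := isStarProjection_starProjection.isSelfAdjoint
  mul_self := isStarProjection_starProjection.isIdempotentElem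
  apply_eq_zero_iff v := by
    have hs : star ω = ω := IsSelfAdjoint.of_nonneg hω
    rw [Submodule.starProjection_apply_eq_zero_iff, Submodule.mem_orthogonal]
    constructor
    · intro h
      refine inner_self_eq_zero (𝕜 := ℂ).mp ?_
      have := h (ω (ω v)) ⟨ω v, rfl⟩
      rwa [← inner_star_apply, hs]
    · rintro h _ ⟨u, rfl⟩
      change inner ℂ (ω u) v = 0
      rw [← hs, inner_star_apply, h, inner_zero_right]

omit [FiniteDimensional ℂ H] in
theorem apply_eq_zero_of_inner_eq_zero {ω : H →L[ℂ] H} (hω : 0 ≤ ω) {v : H}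
    (h : (inner ℂ v (ω v)).re = 0) : ω v = 0 := by
  obtain ⟨R, rfl⟩ := (nonneg_iff_exists_star_mul_self ω).mp hω
  rw [mul_apply_eq_comp, inner_apply_star, inner_self_eq_norm_sq_to_K] at h
  have : R v = 0 := by
    rw [← norm_eq_zero, ← sq_eq_zero_iff]
    exact_mod_cast h
  simp [this]

omit [CompleteSpace H] [FiniteDimensional ℂ H] in
theorem re_inner_apply_nonneg {ω : H →L[ℂ] H} (hω : 0 ≤ ω) (v : H) :
    0 ≤ (inner ℂ v (ω v)).re :=
  ((ContinuousLinearMap.nonneg_iff_isPositive ω).mp hω).re_inner_nonneg_right v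

namespace IsSupport

variable {ω P : H →L[ℂ] H} (hP : IsSupport ω P)

include hP

omit [FiniteDimensional ℂ H] in
theorem mul_eq_zero {B : H →L[ℂ] H} (h : ω * B = 0) : P * B = 0 := by
  ext v
  exact (hP.apply_eq_zero_iff _).mpr (DFunLike.congr_fun h v)

omit [FiniteDimensional ℂ H] in
theorem mul_support {B : H →L[ℂ] H} (h : ∀ v, P v = 0 → B v = 0) : B * P = B := by
  ext v
  have : P (v - P v) = 0 := by
    rw [map_sub, sub_eq_zero]
    exact (DFunLike.congr_fun hP.mul_self v).symm
  have := h _ this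
  rw [map_sub, sub_eq_zero] at this
  exact this.symm

/-- With $\omega=R^*R$ the trace is the squared Hilbert–Schmidt norm of $RB^*$; hence $\omega B^*=0$
and $PB^*=0$. -/
theorem mul_eq_zero_of_tr {B : H →L[ℂ] H} (h : (tr H (B * ω * star B)).re = 0) : B * P = 0 := by
  obtain ⟨R, hR⟩ := (nonneg_iff_exists_star_mul_self ω).mp hP.nonneg
  have h1 : B * star R = 0 := by
    rw [← star_eq_zero]
    refine eq_zero_of_tr_star_mul_self ?_
    rw [← h, hR]
    simp [mul_assoc]
  have h2 : ω * star B = 0 := by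
    have : R * star B = 0 := by simpa using congrArg star h1
    rw [hR, mul_assoc, this, mul_zero]
  simpa [hP.star_eq] using congrArg star (hP.mul_eq_zero h2)

omit [FiniteDimensional ℂ H] in
-- On $\ker\omega$ the form of $\tau$ is squeezed between 0 and $c\langle v,\omega v\rangle=0$.
theorem conj_eq_of_le {τ : H →L[ℂ] H} {c : ℝ} (h0 : 0 ≤ τ) (h : τ ≤ c • ω) : P * τ * P = τ := by
  have h1 : τ * P = τ := by
    refine hP.mul_support fun v hv => apply_eq_zero_of_inner_eq_zero h0 ?_
    have h2 := re_inner_apply_nonneg (sub_nonneg.mpr h) v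
    rw [hP.apply_eq_zero_iff] at hv
    simp only [sub_apply, smul_apply, hv, smul_zero, zero_sub, inner_neg_right,
      Complex.neg_re] at h2
    exact le_antisymm (by linarith) (re_inner_apply_nonneg h0 v)
  have hs : star τ = τ := IsSelfAdjoint.of_nonneg h0
  have h2 : P * τ = τ := by simpa [hP.star_eq, hs] using congrArg star h1
  rw [h2, h1]

end IsSupport

end Support

/-! ### Kraus operators commute with compressed fixed points on the support. -/

section Instrument

variable {H : Type*} [NormedAddCommGroup H] [InnerProductSpace ℂ H] [CompleteSpace H]
  [FiniteDimensional ℂ H] {Ω : Type*} {ι : Ω → Type*} [∀ x, Fintype (ι x)]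
  {K : ∀ x, ι x → (H →L[ℂ] H)} {L : (H →L[ℂ] H) →ₗ[ℂ] (H →L[ℂ] H)}
  (hL : ∀ ρ, HasSum (fun x => ∑ k, K x k * ρ * star (K x k)) (L ρ))
  {ω P : H →L[ℂ] H} (hP : IsSupport ω P) (hω : L ω = ω)

section

include hL

omit [FiniteDimensional ℂ H] in
theorem map_star_of_kraus (ρ : H →L[ℂ] H) : L (star ρ) = star (L ρ) := by
  refine (hL (star ρ)).unique ?_
  convert (hL ρ).star using 2 with x
  simp [mul_assoc]

omit [FiniteDimensional ℂ H] in
theorem map_nonneg_of_kraus {ρ : H →L[ℂ] H} (hρ : 0 ≤ ρ) : 0 ≤ L ρ :=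
  (hL ρ).nonneg fun x => Finset.sum_nonneg fun k _ => star_right_conjugate_nonneg hρ (K x k)

theorem tr_map_mul_star {X : H →L[ℂ] H} (hX : ∀ σ, tr H (L σ * X) = tr H (σ * X))
    (σ : H →L[ℂ] H) : tr H (L σ * star X) = tr H (σ * star X) := by
  have h1 (ρ : H →L[ℂ] H) : tr H (ρ * star X) = star (tr H (star ρ * X)) := by
    rw [← tr_star, star_mul, star_star, tr_mul_comm]
  rw [h1, h1, ← map_star_of_kraus hL, hX]

include hP hω

omit [FiniteDimensional ℂ H] in
-- The support of $\omega$ is invariant under each Kraus operator. For $v\in\ker\omega$, $0=\langle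
-- v,L(\omega)v\rangle$ is a sum of terms $\langle K^*v,\omega K^*v\rangle\ge0$, so
-- $K^*v\in\ker\omega$.
theorem support_mul_kraus (x : Ω) (k : ι x) : P * K x k * P = K x k * P := by
  have hker : ∀ v, P v = 0 → P (star (K x k) v) = 0 := by
    intro v hv
    rw [hP.apply_eq_zero_iff] at hv ⊢
    have hs : HasSum (fun y => ∑ k, (inner ℂ v ((K y k * ω * star (K y k)) v)).re) 0 := by
      have := (hL ω).mapL ((Complex.reCLM : ℂ →L[ℝ] ℝ) ∘L
        ((innerSL ℂ v ∘L ContinuousLinearMap.apply ℂ H v :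
          (H →L[ℂ] H) →L[ℂ] ℂ).restrictScalars ℝ))
      simpa [hω, hv] using this
    have hterm (y) (k : ι y) : 0 ≤ (inner ℂ v ((K y k * ω * star (K y k)) v)).re :=
      re_inner_apply_nonneg (star_right_conjugate_nonneg hP.nonneg _) v
    have h0 := (hasSum_zero_iff_of_nonneg
      (fun y => Finset.sum_nonneg fun k _ => hterm y k)).mp hs
    have h1 := (Finset.sum_eq_zero_iff_of_nonneg fun k _ => hterm x k).mp
      (congrFun h0 x) k (Finset.mem_univ k)
    refine apply_eq_zero_of_inner_eq_zero hP.nonneg ?_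
    rwa [mul_apply_eq_comp, mul_apply_eq_comp, ← inner_star_apply] at h1
  have h1 : P * star (K x k) * P = P * star (K x k) := hP.mul_support hker
  simpa [hP.star_eq, mul_assoc] using congrArg star h1

omit [FiniteDimensional ℂ H] in
theorem support_map_support {σ : H →L[ℂ] H} (hσ : P * σ * P = σ) : P * L σ * P = L σ := by
  have h1 := (((hL σ).mul_left P).mul_right P)
  refine h1.unique (hasSum_of_eq (hL σ) fun x => ?_)
  rw [Finset.mul_sum, Finset.sum_mul]
  refine Finset.sum_congr rfl fun k _ => ?_
  have hk := support_mul_kraus hL hP hω x k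
  have hk' : P * star (K x k) * P = P * star (K x k) := by
    simpa [hP.star_eq, mul_assoc] using congrArg star hk
  calc P * (K x k * σ * star (K x k)) * P
      = (P * K x k * P) * σ * (P * star (K x k) * P) := by
        conv_lhs => rw [← hσ]
        simp only [mul_assoc]
    _ = K x k * (P * σ * P) * star (K x k) := by rw [hk, hk']; simp only [mul_assoc]
    _ = _ := by rw [hσ]

omit [FiniteDimensional ℂ H] in
/-- Compressing a fixed point of the dual to the support of `ω` leaves its pairing with
operators on the support unchanged, before and after the channel. -/
theorem tr_map_mul_compression {X σ : H →L[ℂ] H} (hX : ∀ σ, tr H (L σ * X) = tr H (σ * X))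
    (hσ : P * σ * P = σ) : tr H (L σ * (P * X * P)) = tr H (σ * (P * X * P)) := by
  have h (τ : H →L[ℂ] H) (hτ : P * τ * P = τ) : tr H (τ * (P * X * P)) = tr H (τ * X) := by
    conv_rhs => rw [← hτ]
    rw [← mul_assoc, tr_mul_comm]
    simp only [mul_assoc]
  rw [h _ (support_map_support hL hP hω hσ), h σ hσ, hX]

theorem kraus_mul_compression (htr : ∀ ρ, tr H (L ρ) = tr H ρ)
    {X : H →L[ℂ] H} (hX : ∀ σ, tr H (L σ * X) = tr H (σ * X))
    (x : Ω) (k : ι x) : K x k * (P * X * P) = P * X * P * K x k * P := by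
  set Y := P * X * P with hY
  have hsY : star Y = P * star X * P := by simp [hY, hP.star_eq, mul_assoc]
  have hPY : P * Y = Y := by simp only [hY, ← mul_assoc, hP.mul_self]
  have hYP : Y * P = Y := by simp only [hY, mul_assoc, hP.mul_self]
  have hsYP : star Y * P = star Y := by simpa [hP.star_eq] using congrArg star hPY
  have hωP : ω * P = ω := hP.mul_support fun v => (hP.apply_eq_zero_iff v).mp
  have hPω : P * ω = ω := by
    simpa [hP.star_eq, (IsSelfAdjoint.of_nonneg hP.nonneg).star_eq] using congrArg star hωP
  let B (x) (k : ι x) := K x k * Y - Y * K x k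
  -- Each of the four terms has trace $\operatorname{tr}[Y\omega Y^*]$: by trace preservation, by
  -- invariance of $Y^*$ and of $Y$ against operators on the support, and by $L(\omega)=\omega$. The
  -- signs cancel.
  have hsum : HasSum (fun x => ∑ k, B x k * ω * star (B x k))
      (L (Y * ω * star Y) - L (Y * ω) * star Y - Y * L (ω * star Y) + Y * L ω * star Y) := by
    have := (((hL (Y * ω * star Y)).sub ((hL (Y * ω)).mul_right (star Y))).sub
      ((hL (ω * star Y)).mul_left Y)).add (((hL ω).mul_left Y).mul_right (star Y))
    refine hasSum_of_eq this fun x => ?_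
    simp only [Finset.mul_sum, Finset.sum_mul, ← Finset.sum_sub_distrib,
      ← Finset.sum_add_distrib]
    refine Finset.sum_congr rfl fun k _ => ?_
    simp only [B, star_sub, star_mul]
    noncomm_ring
  have htr1 : tr H (L (Y * ω * star Y)) = tr H (Y * ω * star Y) :=
    htr _
  have htr2 : tr H (L (Y * ω) * star Y) = tr H (Y * ω * star Y) := by
    rw [hsY]
    refine tr_map_mul_compression hL hP hω (tr_map_mul_star hL hX) ?_
    rw [← mul_assoc, hPY, mul_assoc, hωP]
  have htr3 : tr H (Y * L (ω * star Y)) = tr H (Y * ω * star Y) := by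
    rw [tr_mul_comm, tr_map_mul_compression hL hP hω hX, tr_mul_comm, mul_assoc Y]
    rw [← mul_assoc, hPω, mul_assoc, hsYP]
  have hre : HasSum (fun x => ∑ k, (tr H (B x k * ω * star (B x k))).re) 0 := by
    have := hsum.mapL ((Complex.reCLM : ℂ →L[ℝ] ℝ) ∘L
        ((tr H).toContinuousLinearMap.restrictScalars ℝ))
    simpa [hω, htr1, htr2, htr3] using this
  have hterm (y) (k : ι y) : 0 ≤ (tr H (B y k * ω * star (B y k))).re :=
    (norm_nonneg _).trans (norm_le_tr (star_right_conjugate_nonneg hP.nonneg _))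
  have h0 := (hasSum_zero_iff_of_nonneg
    (fun y => Finset.sum_nonneg fun k _ => hterm y k)).mp hre
  have h1 := (Finset.sum_eq_zero_iff_of_nonneg fun k _ => hterm x k).mp
    (congrFun h0 x) k (Finset.mem_univ k)
  have h2 := hP.mul_eq_zero_of_tr h1
  rw [sub_mul, sub_eq_zero, mul_assoc, hYP] at h2
  exact h2

/-- The effects of the instrument, compressed to the support of `ω`, commute with the compressed
fixed points of the dual. -/
theorem effect_mul_compression (htr : ∀ ρ, tr H (L ρ) = tr H ρ)
    {X : H →L[ℂ] H} (hX : ∀ σ, tr H (L σ * X) = tr H (σ * X))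
    (x : Ω) : P * (∑ k, star (K x k) * K x k) * (P * X * P) =
      P * X * P * (∑ k, star (K x k) * K x k) * P := by
  simp only [Finset.mul_sum, Finset.sum_mul]
  refine Finset.sum_congr rfl fun k _ => ?_
  have h1 := kraus_mul_compression hL hP hω htr hX x k
  -- The adjoint of the relation for $X^*$ moves $PXP$ past $K^*$.
  have h2 := congrArg star (kraus_mul_compression hL hP hω htr (tr_map_mul_star hL hX) x k)
  simp only [star_mul, star_star, hP.star_eq] at h2
  calc P * (star (K x k) * K x k) * (P * X * P)
      = P * star (K x k) * (K x k * (P * X * P)) := by simp only [mul_assoc]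
    _ = P * (star (K x k) * (P * (X * P))) * K x k * P := by rw [h1]; simp only [mul_assoc]
    _ = _ := by rw [← h2]; simp only [mul_assoc]

end

end Instrument

/-! ### Compression of operators to a subspace. -/

section Compression

variable {H : Type*} [NormedAddCommGroup H] [InnerProductSpace ℂ H] [FiniteDimensional ℂ H]

/-- The compression of operators to a subspace. -/
def compression (S : Submodule ℂ H) : (H →L[ℂ] H) →ₗ[ℂ] (S →L[ℂ] S) where
  toFun X := S.orthogonalProjectionOnto ∘L X ∘L S.subtypeL
  map_add' X Y := by ext; simp
  map_smul' c X := by ext; simp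

theorem coe_compression_apply (S : Submodule ℂ H) (X : H →L[ℂ] H) (s : S) :
    (compression S X s : H) = (S.starProjection * X * S.starProjection) s := by
  simp [compression]

theorem compression_surjective (S : Submodule ℂ H) : Function.Surjective (compression S) := by
  intro Z
  refine ⟨S.subtypeL ∘L Z ∘L S.orthogonalProjectionOnto, ?_⟩
  ext s
  simp [compression]

theorem compression_one (S : Submodule ℂ H) : compression S 1 = 1 := by
  ext s
  simp [compression]

theorem compression_star [CompleteSpace H] (S : Submodule ℂ H) (X : H →L[ℂ] H) :
    compression S (star X) = star (compression S X) := by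
  ext1 s
  refine ext_inner_left ℂ fun t => ?_
  rw [inner_apply_star, Submodule.coe_inner, Submodule.coe_inner]
  simp only [compression, LinearMap.coe_mk, AddHom.coe_mk, ContinuousLinearMap.comp_apply,
    Submodule.subtypeL_apply]
  rw [← Submodule.coe_inner, ← Submodule.coe_inner,
    Submodule.inner_orthogonalProjectionOnto_eq_of_mem_left,
    Submodule.inner_orthogonalProjectionOnto_eq_of_mem_right, inner_apply_star]

theorem conj_eq_zero_of_compression_eq_zero {S : Submodule ℂ H} {X : H →L[ℂ] H}
    (h : compression S X = 0) : S.starProjection * X * S.starProjection = 0 := by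
  ext v
  have := coe_compression_apply S X (S.orthogonalProjectionOnto v)
  rw [h, Submodule.coe_orthogonalProjectionOnto_apply, mul_apply_eq_comp,
    S.starProjection_eq_self_iff.mpr (S.starProjection_apply_mem v)] at this
  exact this.symm

theorem compression_mul_comm {S : Submodule ℂ H} {X Y : H →L[ℂ] H}
    (h : S.starProjection * X * (S.starProjection * Y * S.starProjection) =
      S.starProjection * Y * S.starProjection * X * S.starProjection) :
    compression S X * compression S Y = compression S Y * compression S X := by
  ext s
  have h1 := DFunLike.congr_fun h (s : H)
  simpa [compression] using h1

/-- The loss of dimension is at most that of the whole kernel of the compression, $(\dim\mathcal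
H)^2-(\dim S)^2$. -/
theorem finrank_le_finrank_map_compression (S : Submodule ℂ H) (C : Submodule ℂ (H →L[ℂ] H)) :
    Module.finrank ℂ C + Module.finrank ℂ S ^ 2 ≤
      Module.finrank ℂ (C.map (compression S)) + Module.finrank ℂ H ^ 2 := by
  have h1 := LinearMap.finrank_range_add_finrank_ker (compression S)
  rw [LinearMap.range_eq_top.mpr (compression_surjective S), finrank_top, finrank_operators,
    finrank_operators] at h1
  have h2 := LinearMap.finrank_range_add_finrank_ker ((compression S).domRestrict C)
  rw [LinearMap.range_domRestrict] at h2
  have h3 : Module.finrank ℂ (LinearMap.ker ((compression S).domRestrict C)) ≤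
      Module.finrank ℂ (LinearMap.ker (compression S)) := by
    refine LinearMap.finrank_le_finrank_of_injective
      (f := C.subtype.restrict (p := LinearMap.ker ((compression S).domRestrict C))
        (q := LinearMap.ker (compression S)) fun x hx => hx) ?_
    intro x y hxy
    exact Subtype.ext (Subtype.ext (congrArg (LinearMap.ker (compression S)).subtype hxy))
  omega

end Compression

/-! ### Fixed points, effects and the final count. -/

section Main

variable {H : Type*} [NormedAddCommGroup H] [InnerProductSpace ℂ H] [CompleteSpace H]
  [FiniteDimensional ℂ H]

theorem mem_fixDual_iff {Λ : Channel H} {X : H →L[ℂ] H} :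
    X ∈ Λ.fixDual ↔ ∀ ρ, tr H (Λ.toLinearMap ρ * X) = tr H (ρ * X) := by
  change dual Λ.toLinearMap X = X ↔ _
  constructor
  · intro h ρ
    rw [tr_dual, h]
  · intro h
    refine eq_of_tr_mul_eq fun ρ => ?_
    rw [← tr_dual, h]

omit [CompleteSpace H] in
theorem eq_zero_of_tr_mul_eq_zero {X : H →L[ℂ] H} (h : ∀ ρ, 0 ≤ ρ → tr H (ρ * X) = 0) :
    X = 0 := by
  refine ContinuousLinearMap.coe_injective ((inner_map_self_eq_zero (X : H →ₗ[ℂ] H)).mp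
    fun v => ?_)
  have := h (rankOne ℂ v v)
    ((ContinuousLinearMap.nonneg_iff_isPositive _).mpr (isPositive_rankOne_self v))
  rw [tr_mul_comm, tr_mul_rankOne] at this
  rw [← inner_conj_symm]
  simp [this]

omit [CompleteSpace H] in
theorem Observable.one_mem_lnr {Ω : Type*} (A : Observable Ω H) : (1 : H →L[ℂ] H) ∈ A.lnr :=
  (Submodule.closed_of_finiteDimensional A.lnr).mem_of_tendsto A.hasSum_one
    (Filter.Eventually.of_forall fun _ =>
      Submodule.sum_mem _ fun x _ => Submodule.subset_span ⟨x, rfl⟩)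

end Main

end QuantumMeasurement

end

open QuantumMeasurement in
theorem theorem4 {Ω H : Type*} [Countable Ω]
    [NormedAddCommGroup H] [InnerProductSpace ℂ H] [CompleteSpace H] [FiniteDimensional ℂ H]
    (A : QuantumMeasurement.Observable Ω H) (Λ : QuantumMeasurement.Channel H)
    (h : QuantumMeasurement.Compatible A Λ) :
    Module.finrank ℂ A.lnr + Module.finrank ℂ Λ.fixDual ≤ Module.finrank ℂ H ^ 2 + 1 := by
  obtain ⟨I, hI, hsum⟩ := h
  choose n K hK using fun x => exists_kraus (I x)
  have hL (ρ) : HasSum (fun x => ∑ k, K x k * ρ * star (K x k)) (Λ.toLinearMap ρ) :=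
    hasSum_of_eq (hsum ρ) fun x => (hK x ρ).symm
  have heff (x) : A.effect x = ∑ k, star (K x k) * K x k := by
    refine eq_of_tr_mul_eq fun ρ => ?_
    rw [← hI, hK, Finset.mul_sum, map_sum, map_sum]
    refine Finset.sum_congr rfl fun k _ => ?_
    rw [mul_assoc, tr_mul_comm, mul_assoc]
  have htr := Λ.trace_preserving
  obtain ⟨ω, hω0, hω, hdom⟩ :=
    exists_dominating_fixedPoint (fun ρ hρ => map_nonneg_of_kraus hL hρ) htr
  have hP := isSupport_starProjection_range hω0
  set S := ω.range
  -- A fixed point $X$ satisfies $\operatorname{tr}[\rho X]=\operatorname{tr}[\tau X]$ with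
  -- $\tau=P\tau P$, so $PXP=0$ forces $X=0$.
  have hinj : Module.finrank ℂ Λ.fixDual =
      Module.finrank ℂ (Λ.fixDual.map (compression S)) := by
    rw [← LinearMap.range_domRestrict]
    refine (LinearMap.finrank_range_of_inj ?_).symm
    rw [injective_iff_map_eq_zero]
    rintro ⟨X, hX⟩ h0
    have h1 := conj_eq_zero_of_compression_eq_zero (S := S) (X := X) h0
    refine Subtype.ext (eq_zero_of_tr_mul_eq_zero fun ρ hρ => ?_)
    obtain ⟨τ, c, hτ0, hτ, hτX⟩ := hdom ρ hρ
    rw [hτX X (mem_fixDual_iff.mp hX), ← hP.conj_eq_of_le hτ0 hτ, mul_assoc, mul_assoc,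
      tr_mul_comm, mul_assoc, mul_assoc, ← mul_assoc _ X, h1, mul_zero, map_zero]
  have hcomm : ∀ m ∈ Λ.fixDual.map (compression S), ∀ c ∈ A.lnr.map (compression S),
      m * c = c * m := by
    rintro _ ⟨X, hX, rfl⟩ _ ⟨a, ha, rfl⟩
    induction ha using Submodule.span_induction with
    | mem a ha =>
      obtain ⟨x, rfl⟩ := ha
      rw [heff]
      exact (compression_mul_comm
        (effect_mul_compression hL hP hω htr (mem_fixDual_iff.mp hX) x)).symm
    | zero => simp
    | add a b _ _ ha hb => rw [map_add, mul_add, add_mul, ha, hb]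
    | smul c a _ ha =>
      ext1 s
      have := congrArg (c • ·) (DFunLike.congr_fun ha s)
      simpa using this
  -- The fixed points play the self-adjoint space; the span of the effects only needs to contain
  -- $\mathbb 1$.
  have hmain := finrank_add_finrank_le_of_commute (Λ.fixDual.map (compression S))
    (A.lnr.map (compression S))
    (by
      rintro _ ⟨X, hX, rfl⟩
      exact ⟨star X, mem_fixDual_iff.mpr (tr_map_mul_star hL (mem_fixDual_iff.mp hX)),
        compression_star S X⟩)
    ⟨1, mem_fixDual_iff.mpr fun ρ => by simpa using htr ρ, compression_one S⟩
    ⟨1, A.one_mem_lnr, compression_one S⟩ hcomm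
  have hdim := finrank_le_finrank_map_compression S A.lnr
  omega
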